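/- Let $P$ be a finite poset, and let $\mathrm{LE}(Q)$ denote the number of linear extensions of a finite poset $Q$. Let $\mathrm{IG}_P$ be the incomparability graph of $P$: its vertices are the elements of $P$, and two elements are joined by an edge exactly when they are incomparable. Let $\mathcal M=\{M_1,\dots,M_N\}$ be a modular partition of $\mathrm{IG}_P$, that is, a partition of $P$ into non-empty sets $M_k$ such that all elements of $M_k$ have the same neighbours in $P\setminus M_k$. Suppose that the skeleton $\mathrm{IG}_P/\mathcal M$ (the graph with one vertex for each module, two distinct modules being joined when there are edges of $\mathrm{IG}_P$ between them) is the path $M_1-M_2-\cdots-M_N$; that is, $M_a$ and $M_b$ are joined if and only if $|a-b|=1$. Put $m_k=|M_k|$ for $1\le k\le N$. Then $$\mathrm{LE}(P)=\prod_{s=1}^{N}\mathrm{LE}(M_s)\;\sum_{\substack{0\le i_x\le m_x\\ x=1,\dots,N-1}}\;\prod_{d=0}^{N}\binom{m_d-i_d+i_{d+1}-1}{m_d-i_d},$$ where each $M_s$ carries the order induced from $P$, $i_N=m_N$, and the boundary conventions are $m_0=i_0=i_{N+1}=0$. Binomial coefficients are the generalized ones, so that $\binom{-1}{0}=1$ and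 $\binom{n-1}{n}=0$ for $n>0$. (The factors for $d=0$ and $d=N$ are equal to $1$.) -/

import Mathlib

/-- The incomparability graph of a poset: `s - t` is an edge iff neither `s ≤ t` nor `t ≤ s`. -/
def incompGraph (P : Type*) [PartialOrder P] : SimpleGraph P where
  Adj s t := ¬ s ≤ t ∧ ¬ t ≤ s
  symm := ⟨fun _ _ h => ⟨h.2, h.1⟩⟩
  loopless := ⟨fun s h => h.1 (le_refl s)⟩

/-- A module of `G`: a non-empty set of vertices, all having the same neighbours outside the
set. -/
def IsGraphModule {V : Type*} (G : SimpleGraph V) (M : Set V) : Prop :=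
  M.Nonempty ∧ ∀ x ∈ M, ∀ y ∈ M, ∀ z, z ∉ M → (G.Adj x z ↔ G.Adj y z)

/-- The indexed family `M` is a modular partition of `G`: its members are modules, they are
pairwise disjoint, and they cover the vertex set. -/
structure IsModularPartition {V ι : Type*} (G : SimpleGraph V) (M : ι → Set V) : Prop where
  isModule : ∀ i, IsGraphModule G (M i)
  disjoint : ∀ i j, i ≠ j → Disjoint (M i) (M j)
  cover : ∀ v, ∃ i, v ∈ M i

/-- The skeleton `G / M`: one vertex for each module, and an edge between two distinct modules iff
there are edges of `G` between their vertices. -/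
def skeleton {V ι : Type*} (G : SimpleGraph V) (M : ι → Set V) : SimpleGraph ι where
  Adj i j := i ≠ j ∧ ∃ x ∈ M i, ∃ y ∈ M j, G.Adj x y
  symm := ⟨fun _ _ h => ⟨h.1.symm, let ⟨x, hx, y, hy, e⟩ := h.2; ⟨y, hy, x, hx, e.symm⟩⟩⟩
  loopless := ⟨fun _ h => h.1 rfl⟩

/-- The linear extensions of a poset: total orders `r` on its elements such that `x ≤ y` implies
`r x y`. -/
def linearExtensions (P : Type*) [PartialOrder P] : Set (P → P → Prop) :=
  {r | IsLinearOrder P r ∧ ∀ x y, x ≤ y → r x y}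

/-- The number of linear extensions. -/
noncomputable def numLinearExtensions (P : Type*) [PartialOrder P] : ℕ :=
  (linearExtensions P).ncard

/-- A tuple `a_1, …, a_N` (stored with indices `0, …, N - 1`) as a function of the index
`d = 1, …, N`, with the boundary convention `a_0 = a_{N+1} = 0`. -/
def oneIndexed {N : ℕ} (a : Fin N → ℕ) (d : ℕ) : ℕ :=
  if h : 1 ≤ d ∧ d ≤ N then a ⟨d - 1, by omega⟩ else 0

/-- The index tuples `(i_1, …, i_N)` of the sum: `0 ≤ i_x ≤ m_x` for `x = 1, …, N - 1`, and
`i_N = m_N`. -/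
def indexTuples {N : ℕ} (m : Fin N → ℕ) : Finset (Fin N → ℕ) :=
  Fintype.piFinset fun s : Fin N =>
    if (s : ℕ) + 1 = N then {m s} else Finset.range (m s + 1)

/-!
The linear extensions of a relation `R` on a finite set are counted by their first element, which
runs through the `R`-minimal elements (`linExtCount_eq_sum`). Suppose first that all elements of
`M_a` lie below all elements of `M_b` whenever `a + 2 ≤ b`. As long as `M_1` is not empty, the
minimal elements are those of `M_1` and those of `M_2`; once `M_1` is exhausted, `M_2` takes its
place. So, after division by the product of the `LE(M_s)`, the number of linear extensions depends
only on the sizes and satisfies Pascal's rule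
`S(a + 1, b + 1, …) = S(a, b + 1, …) + S(a + 1, b, …)`, with `S(0, b, …) = S(b, …)` and
`S(a, 0, …) = S(0, …)`, where the dots stand for the sizes of the later modules. The sum of products
of binomial coefficients obeys the same rules: written recursively it is `chainSum`, and Pascal's
rule is `chainSum_zero_succ_succ`. Induction with sets allowed to be empty gives
`IsPathLayered.linExtCount_listUnion`.

It remains to orient the comparabilities between modules. For `N ≤ 2` there are none. For `N ≥ 4`
they all go up or all go down (`rel_of_path`), and passing to the dual order does not change any
number of linear extensions. For `N = 3` the modules `M_1` and `M_3` can be interleaved; then their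
union has `LE(M_1) LE(M_3)` linear extensions (`linExtCount_union_of_comparable`), it is unrelated
to `M_2`, and the case of two modules applies, since `S(a, b, c) = S(a + c, b)`.
-/

/-! ### Linear extensions of a relation on a finite set -/

/-- The linear extensions of an arbitrary relation `R`: the total orders containing `R`. For the
order relation of a poset this is `linearExtensions`. -/
def linExt {α : Type*} (R : α → α → Prop) : Set (α → α → Prop) :=
  {r | IsLinearOrder α r ∧ ∀ x y, R x y → r x y}

/-- The number of linear extensions of the restriction of `R` to the finite set `s`. -/
noncomputable def linExtCount {α : Type*} (R : α → α → Prop) (s : Finset α) : ℕ :=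
  (linExt fun x y : s => R x y).ncard

theorem isLinearOrder_iff {α : Type*} {r : α → α → Prop} :
    IsLinearOrder α r ↔ (∀ x, r x x) ∧ (∀ x y z, r x y → r y z → r x z) ∧
      (∀ x y, r x y → r y x → x = y) ∧ ∀ x y, r x y ∨ r y x :=
  ⟨fun h => ⟨h.refl, h.trans, h.antisymm, h.total⟩, fun h =>
    { refl := h.1, trans := h.2.1, antisymm := h.2.2.1, total := h.2.2.2 }⟩

theorem linExt_ncard_congr {α β : Type*} {R : α → α → Prop} {S : β → β → Prop} (e : α ≃ β)
    (h : ∀ x y, R x y ↔ S (e x) (e y)) : (linExt R).ncard = (linExt S).ncard := by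
  refine Set.ncard_congr (fun r _ x y => r (e.symm x) (e.symm y)) ?_ ?_ ?_
  · rintro r ⟨hr, hR⟩
    rw [isLinearOrder_iff] at hr
    refine ⟨isLinearOrder_iff.2 ⟨fun _ => hr.1 _, fun _ _ _ => hr.2.1 _ _ _, fun x y hxy hyx =>
      e.symm.injective (hr.2.2.1 _ _ hxy hyx), fun _ _ => hr.2.2.2 _ _⟩, fun x y hxy => ?_⟩
    exact hR _ _ ((h _ _).2 (by simpa using hxy))
  · intro r r' _ _ hrr
    funext x y
    simpa using congrFun (congrFun hrr (e x)) (e y)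
  · rintro r ⟨hr, hR⟩
    rw [isLinearOrder_iff] at hr
    refine ⟨fun x y => r (e x) (e y), ⟨isLinearOrder_iff.2 ⟨fun _ => hr.1 _,
      fun _ _ _ => hr.2.1 _ _ _, fun x y hxy hyx => e.injective (hr.2.2.1 _ _ hxy hyx),
      fun _ _ => hr.2.2.2 _ _⟩, fun x y hxy => hR _ _ ((h _ _).1 hxy)⟩, ?_⟩
    funext x y
    simp

theorem linExt_flip_ncard {α : Type*} (R : α → α → Prop) :
    (linExt (flip R)).ncard = (linExt R).ncard := by
  have key : ∀ (R : α → α → Prop) r, r ∈ linExt R → flip r ∈ linExt (flip R) := by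
    rintro R r ⟨hr, hR⟩
    rw [isLinearOrder_iff] at hr
    exact ⟨isLinearOrder_iff.2 ⟨hr.1, fun x y z hxy hyz => hr.2.1 z y x hyz hxy,
      fun x y hxy hyx => hr.2.2.1 _ _ hyx hxy, fun x y => hr.2.2.2 y x⟩,
      fun x y hxy => hR y x hxy⟩
  refine (Set.ncard_congr (fun r _ => flip r) (key R) ?_ ?_).symm
  · intro r r' _ _ h
    exact congrArg flip h
  · intro r hr
    exact ⟨flip r, key (flip R) r hr, rfl⟩

theorem linExtCount_flip {α : Type*} (R : α → α → Prop) (s : Finset α) :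
    linExtCount (flip R) s = linExtCount R s :=
  linExt_flip_ncard fun x y : s => R x y

/-- A linear extension with first element `x` is determined by its restriction to the other
elements, and every linear extension of the rest arises, provided that `x` is `R`-minimal. -/
theorem ncard_linExt_first {α : Type*} (R : α → α → Prop) (x : α) (hx : ∀ y, R y x → y = x) :
    {r ∈ linExt R | ∀ y, r x y}.ncard = (linExt fun y z : {y // y ≠ x} => R y z).ncard := by
  refine Set.ncard_congr (fun r _ y z => r y z) ?_ ?_ ?_
  · rintro r ⟨⟨hr, hR⟩, -⟩
    rw [isLinearOrder_iff] at hr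
    exact ⟨isLinearOrder_iff.2 ⟨fun _ => hr.1 _, fun _ _ _ => hr.2.1 _ _ _,
      fun y z hyz hzy => Subtype.ext (hr.2.2.1 _ _ hyz hzy), fun _ _ => hr.2.2.2 _ _⟩,
      fun y z hyz => hR _ _ hyz⟩
  · rintro r r' ⟨⟨hr, -⟩, hrx⟩ ⟨⟨hr', -⟩, hrx'⟩ h
    rw [isLinearOrder_iff] at hr hr'
    funext y z
    by_cases hy : y = x
    · subst hy
      simp [hrx z, hrx' z]
    by_cases hz : z = x
    · subst hz
      have h1 : ¬ r y z := fun h => hy (hr.2.2.1 _ _ h (hrx y))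
      have h2 : ¬ r' y z := fun h => hy (hr'.2.2.1 _ _ h (hrx' y))
      simp [h1, h2]
    exact congrFun (congrFun h ⟨y, hy⟩) ⟨z, hz⟩
  · rintro r ⟨hr, hR⟩
    rw [isLinearOrder_iff] at hr
    obtain ⟨h1, h2, h3, h4⟩ := hr
    refine ⟨fun y z => y = x ∨ ∃ (hy : y ≠ x) (hz : z ≠ x), r ⟨y, hy⟩ ⟨z, hz⟩,
      ⟨⟨isLinearOrder_iff.2 ⟨?_, ?_, ?_, ?_⟩, ?_⟩, ?_⟩, ?_⟩
    · intro y
      by_cases hy : y = x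
      · exact .inl hy
      · exact .inr ⟨hy, hy, h1 _⟩
    · rintro y z w (hy | ⟨hy, hz, hyz⟩) (hz' | ⟨hz', hw, hzw⟩)
      · exact .inl hy
      · exact .inl hy
      · exact absurd hz' hz
      · exact .inr ⟨hy, hw, h2 _ _ _ hyz hzw⟩
    · rintro y z (hy | ⟨hy, hz, hyz⟩) (hz' | ⟨hz', hw, hzw⟩)
      · exact hy.trans hz'.symm
      · exact absurd hy hw
      · exact absurd hz' hz
      · exact congrArg Subtype.val (h3 _ _ hyz hzw)
    · intro y z
      by_cases hy : y = x
      · exact .inl (.inl hy)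
      by_cases hz : z = x
      · exact .inr (.inl hz)
      exact (h4 ⟨y, hy⟩ ⟨z, hz⟩).imp (fun h => .inr ⟨hy, hz, h⟩) fun h => .inr ⟨hz, hy, h⟩
    · intro y z hyz
      by_cases hy : y = x
      · exact .inl hy
      · have hz : z ≠ x := by
          rintro rfl
          exact hy (hx _ hyz)
        exact .inr ⟨hy, hz, hR ⟨y, hy⟩ ⟨z, hz⟩ hyz⟩
    · exact fun y => .inl rfl
    · funext y z
      simp [y.2, z.2]

theorem exists_first {α : Type*} [Finite α] [Nonempty α] {r : α → α → Prop}
    (hr : IsLinearOrder α r) : ∃ x, ∀ y, r x y := by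
  rw [isLinearOrder_iff] at hr
  obtain ⟨h1, h2, -, h4⟩ := hr
  let _ : Preorder α := { le := r, le_refl := h1, le_trans := h2 }
  obtain ⟨x, hx⟩ := Set.finite_univ.exists_minimal (Set.univ_nonempty (α := α))
  exact ⟨x, fun y => (h4 x y).elim id (hx.2 (Set.mem_univ y))⟩

open Classical in
theorem ncard_linExt_eq_sum {α : Type*} [Fintype α] [Nonempty α] (R : α → α → Prop) :
    (linExt R).ncard = ∑ x with ∀ y, R y x → y = x,
      (linExt fun y z : {y // y ≠ x} => R y z).ncard := by
  have h : linExt R =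
      ⋃ x ∈ Finset.univ.filter (fun x : α => ∀ y, R y x → y = x), {r ∈ linExt R | ∀ y, r x y} := by
    ext r
    simp only [Set.mem_iUnion, Finset.mem_filter, Finset.mem_univ, true_and]
    constructor
    · intro hr
      obtain ⟨x, hx⟩ := exists_first hr.1
      exact ⟨x, fun y hy => (isLinearOrder_iff.1 hr.1).2.2.1 _ _ (hr.2 _ _ hy) (hx y), hr, hx⟩
    · rintro ⟨x, -, hr, -⟩
      exact hr
  rw [h]
  refine (Set.Finite.ncard_biUnion (Finset.finite_toSet _) (fun _ _ => Set.toFinite _) ?_).trans ?_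
  · intro x _ y _ hxy
    refine Set.disjoint_left.2 fun r hx hy => hxy ?_
    exact (isLinearOrder_iff.1 hx.1.1).2.2.1 _ _ (hx.2 y) (hy.2 x)
  · rw [finsum_mem_coe_finset]
    exact Finset.sum_congr rfl fun x hx => ncard_linExt_first R x (Finset.mem_filter.1 hx).2

theorem linExtCount_empty {α : Type*} (R : α → α → Prop) : linExtCount R ∅ = 1 := by
  rw [linExtCount, Set.ncard_eq_one]
  refine ⟨fun _ _ => True, ?_⟩
  ext r
  constructor
  · intro _
    funext x
    exact absurd x.2 (Finset.notMem_empty _)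
  · rintro rfl
    refine ⟨isLinearOrder_iff.2 ⟨?_, ?_, ?_, ?_⟩, ?_⟩ <;>
    exact fun x => absurd x.2 (Finset.notMem_empty _)

/-- The `R`-minimal elements of `s`. -/
noncomputable def minSet {α : Type*} (R : α → α → Prop) (s : Finset α) : Finset α :=
  open Classical in s.filter fun x => ∀ y ∈ s, R y x → y = x

theorem mem_minSet {α : Type*} {R : α → α → Prop} {s : Finset α} {x : α} :
    x ∈ minSet R s ↔ x ∈ s ∧ ∀ y ∈ s, R y x → y = x := by
  simp [minSet]

/-- Linear extensions are counted by their first element, which is minimal. -/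
theorem linExtCount_eq_sum {α : Type*} [DecidableEq α] (R : α → α → Prop) {s : Finset α}
    (hs : s.Nonempty) : linExtCount R s = ∑ x ∈ minSet R s, linExtCount R (s.erase x) := by
  have := hs.to_subtype
  rw [linExtCount, ncard_linExt_eq_sum]
  refine Finset.sum_bij (fun x _ => x.1) ?_ ?_ ?_ ?_
  · intro x hx
    simp only [Finset.mem_filter, Finset.mem_univ, true_and, Subtype.forall] at hx
    exact mem_minSet.2 ⟨x.2, fun y hy hyx => congrArg Subtype.val (hx y hy hyx)⟩
  · exact fun x _ y _ h => Subtype.ext h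
  · intro x hx
    rw [mem_minSet] at hx
    exact ⟨⟨x, hx.1⟩, by simpa using hx.2, rfl⟩
  · intro x _
    refine linExt_ncard_congr (R := fun y z : {y : s // y ≠ x} => R y z)
      (S := fun y z : s.erase x.1 => R y z)
      { toFun := fun y => ⟨y.1.1, Finset.mem_erase.2 ⟨fun h => y.2 (Subtype.ext h), y.1.2⟩⟩
        invFun := fun y => ⟨⟨y.1, (Finset.mem_erase.1 y.2).2⟩,
          fun h => (Finset.mem_erase.1 y.2).1 (congrArg Subtype.val h)⟩
        left_inv := fun _ => rfl
        right_inv := fun _ => rfl } fun _ _ => Iff.rfl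

/-! ### The sum of products of binomial coefficients -/

/-- The sum of products of multiset coefficients attached to the list of module sizes
`m₁, …, m_N`, in recursive form. The argument `p` is the lower index of the coefficient whose
upper index is the first summation index, so that `chainSum 0` is the sum of the theorem. -/
def chainSum : ℕ → List ℕ → ℕ
  | p, [] => Nat.multichoose 0 p
  | p, m :: l => ∑ i ∈ Finset.range (m + 1), Nat.multichoose i p * chainSum (m - i) l

theorem sum_range_multichoose (i m : ℕ) :
    ∑ k ∈ Finset.range (m + 1), Nat.multichoose i k = Nat.multichoose (i + 1) m := by
  induction m with
  | zero => simp
  | succ m ih => rw [Finset.sum_range_succ, ih, Nat.multichoose_succ_succ, add_comm]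

theorem chainSum_zero_singleton (m : ℕ) : chainSum 0 [m] = 1 := by
  simp only [chainSum, Nat.multichoose_zero_right, one_mul]
  rw [Finset.sum_range_succ, Finset.sum_eq_zero]
  · simp
  · intro i hi
    obtain ⟨k, hk⟩ := Nat.exists_eq_add_of_lt (Finset.mem_range.1 hi)
    rw [show m - i = k + 1 by omega, Nat.multichoose_zero_succ]

theorem chainSum_zero_cons_zero (l : List ℕ) : chainSum 0 (0 :: l) = chainSum 0 l := by
  simp [chainSum]

theorem chainSum_zero_cons_cons (a b : ℕ) (l : List ℕ) :
    chainSum 0 (a :: b :: l) =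
      ∑ i ∈ Finset.range (b + 1), Nat.multichoose (i + 1) a * chainSum (b - i) l := by
  simp only [chainSum, Nat.multichoose_zero_right, one_mul]
  rw [Finset.sum_comm]
  refine Finset.sum_congr rfl fun i _ => ?_
  rw [← Finset.sum_mul, ← sum_range_multichoose, ← Finset.sum_range_reflect]
  congr 1
  refine Finset.sum_congr rfl fun k hk => ?_
  congr 1
  have := Finset.mem_range.1 hk
  omega

theorem chainSum_zero_cons_zero_cons (a : ℕ) (l : List ℕ) :
    chainSum 0 (a :: 0 :: l) = chainSum 0 l := by
  simp [chainSum_zero_cons_cons, Nat.multichoose_one]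

/-- Pascal's rule for `chainSum`: the first element of a linear extension lies in the first or in
the second module. -/
theorem chainSum_zero_succ_succ (a b : ℕ) (l : List ℕ) :
    chainSum 0 ((a + 1) :: (b + 1) :: l) =
      chainSum 0 (a :: (b + 1) :: l) + chainSum 0 ((a + 1) :: b :: l) := by
  simp only [chainSum_zero_cons_cons, Nat.multichoose_succ_succ _ a, add_mul,
    Finset.sum_add_distrib]
  rw [add_comm]
  congr 1
  rw [Finset.sum_range_succ']
  simp [Nat.multichoose_succ_succ, add_mul, Finset.sum_add_distrib]

theorem chainSum_zero_pair (a b : ℕ) : chainSum 0 [a, b] = (a + b).choose b := by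
  induction a generalizing b with
  | zero => simp [chainSum_zero_cons_zero, chainSum_zero_singleton]
  | succ a iha =>
    induction b with
    | zero =>
      rw [chainSum_zero_cons_zero_cons]
      simp [chainSum]
    | succ b ihb =>
      rw [chainSum_zero_succ_succ, iha, ihb, show a + 1 + (b + 1) = (a + b + 1) + 1 by ring,
        Nat.choose_succ_succ', add_comm]
      congr 2
      ring

theorem chainSum_zero_triple (a b c : ℕ) : chainSum 0 [a, b, c] = (a + b + c).choose b := by
  induction a generalizing b with
  | zero =>
    rw [chainSum_zero_cons_zero, chainSum_zero_pair, zero_add, Nat.choose_symm_add]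
  | succ a iha =>
    induction b with
    | zero => simp [chainSum_zero_cons_zero_cons, chainSum_zero_singleton]
    | succ b ihb =>
      rw [chainSum_zero_succ_succ, iha, ihb,
        show a + 1 + (b + 1) + c = (a + b + c + 1) + 1 by ring, Nat.choose_succ_succ', add_comm]
      congr 2 <;> ring

theorem oneIndexed_succ {N : ℕ} (a : Fin N → ℕ) (s : Fin N) : oneIndexed a (s + 1) = a s := by
  simp [oneIndexed]

theorem oneIndexed_zero {N : ℕ} (a : Fin N → ℕ) : oneIndexed a 0 = 0 := by
  simp [oneIndexed]

theorem oneIndexed_of_lt {N : ℕ} (a : Fin N → ℕ) {d : ℕ} (hd : N < d) : oneIndexed a d = 0 := by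
  simp [oneIndexed, hd]

theorem oneIndexed_cons_one {N : ℕ} (x : ℕ) (a : Fin N → ℕ) :
    oneIndexed (Fin.cons x a : Fin (N + 1) → ℕ) 1 = x := by
  simp [oneIndexed]

theorem oneIndexed_cons_succ {N : ℕ} (x : ℕ) (a : Fin N → ℕ) (d : ℕ) :
    oneIndexed (Fin.cons x a : Fin (N + 1) → ℕ) (d + 2) = oneIndexed a (d + 1) := by
  by_cases h : d + 1 ≤ N
  · have h1 := oneIndexed_succ (Fin.cons x a : Fin (N + 1) → ℕ) (Fin.succ ⟨d, h⟩)
    have h2 := oneIndexed_succ a ⟨d, h⟩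
    exact h1.trans ((Fin.cons_succ _ _ _).trans h2.symm)
  · rw [oneIndexed_of_lt _ (by omega), oneIndexed_of_lt _ (by omega)]

theorem sum_piFinset_eq_chainSum {N : ℕ} (m : Fin N → ℕ) (p : ℕ) :
    ∑ i ∈ Fintype.piFinset fun s => Finset.range (m s + 1),
      Nat.multichoose (oneIndexed i 1) p * ∏ d ∈ Finset.range N,
        Nat.multichoose (oneIndexed i (d + 2)) (oneIndexed m (d + 1) - oneIndexed i (d + 1)) =
      chainSum p (List.ofFn m) := by
  induction N generalizing p with
  | zero => simp [chainSum, oneIndexed]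
  | succ N ih =>
    rw [List.ofFn_succ, chainSum]
    simp only [← ih, Finset.mul_sum]
    rw [← Finset.sum_product']
    refine Finset.sum_bij' (fun i _ => (i 0, Fin.tail i)) (fun x _ => Fin.cons x.1 x.2)
      ?_ ?_ ?_ ?_ ?_
    · intro i hi
      rw [Fintype.mem_piFinset] at hi
      exact Finset.mem_product.2 ⟨hi 0, Fintype.mem_piFinset.2 fun s => hi s.succ⟩
    · rintro ⟨x, i⟩ hi
      rw [Finset.mem_product, Fintype.mem_piFinset] at hi
      exact Fintype.mem_piFinset.2 (Fin.cases hi.1 hi.2)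
    · intro i _
      exact Fin.cons_self_tail i
    · intro x _
      simp
    · intro i _
      obtain ⟨x, t, rfl⟩ : ∃ x t, i = Fin.cons x t := ⟨i 0, Fin.tail i, (Fin.cons_self_tail i).symm⟩
      obtain ⟨y, n, rfl⟩ : ∃ y n, m = Fin.cons y n := ⟨m 0, Fin.tail m, (Fin.cons_self_tail m).symm⟩
      rw [Finset.prod_range_succ']
      simp only [oneIndexed_cons_one, oneIndexed_cons_succ, zero_add, Fin.cons_zero, Fin.tail_cons,
        Fin.cons_succ]
      rw [mul_comm (∏ _ ∈ _, _)]

theorem ringChoose_eq_multichoose {a b c : ℕ} (h : b ≤ a) :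
    Ring.choose ((a : ℤ) - b + c - 1) (a - b) = (Nat.multichoose c (a - b) : ℤ) := by
  rw [show (a : ℤ) - b + c - 1 = c + (a - b : ℕ) - 1 by push_cast [h]; ring,
    ← Ring.multichoose_eq]
  generalize a - b = k
  rcases Nat.eq_zero_or_pos c with rfl | hc
  · cases k <;> simp
  · rw [Ring.multichoose_eq, Nat.multichoose_eq, ← Ring.choose_natCast,
      Nat.cast_sub (by omega), Nat.cast_add, Nat.cast_one]

/-- The restriction `i_N = m_N` may be dropped from the sum: a tuple violating it contributes
`0`. -/
theorem sum_indexTuples_eq_chainSum {N : ℕ} (m : Fin N → ℕ) :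
    ∑ i ∈ indexTuples m, ∏ d ∈ Finset.range (N + 1),
        Ring.choose
          ((oneIndexed m d : ℤ) - (oneIndexed i d : ℤ) + (oneIndexed i (d + 1) : ℤ) - 1)
          (oneIndexed m d - oneIndexed i d) = (chainSum 0 (List.ofFn m) : ℤ) := by
  have hsub : indexTuples m ⊆ Fintype.piFinset fun s => Finset.range (m s + 1) := by
    refine Fintype.piFinset_subset _ _ fun s => ?_
    split_ifs <;> simp
  rw [← sum_piFinset_eq_chainSum, Nat.cast_sum]
  rw [← Finset.sum_subset hsub]
  · refine Finset.sum_congr rfl fun i hi => ?_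
    have hi' := Fintype.mem_piFinset.1 (hsub hi)
    have hle : ∀ d, oneIndexed i d ≤ oneIndexed m d := by
      intro d
      unfold oneIndexed
      split_ifs with h
      · exact Nat.lt_succ_iff.1 (Finset.mem_range.1 (hi' _))
      · exact le_rfl
    simp only [ringChoose_eq_multichoose (hle _)]
    rw [Finset.prod_range_succ']
    simp [oneIndexed_zero]
  · intro i hi hni
    rw [Fintype.mem_piFinset] at hi
    have : ∃ s : Fin N, (s : ℕ) + 1 = N ∧ i s ≠ m s := by
      by_contra! hcon
      refine hni (Fintype.mem_piFinset.2 fun s => ?_)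
      split_ifs with hs
      · simpa using hcon s hs
      · exact hi s
    obtain ⟨s, hs, hne⟩ := this
    have hlt : i s < m s :=
      lt_of_le_of_ne (Nat.lt_succ_iff.1 (Finset.mem_range.1 (hi s))) hne
    rw [Finset.prod_eq_zero (Finset.mem_range.2 s.2), mul_zero, Nat.cast_zero]
    rw [oneIndexed_of_lt i (by omega), oneIndexed_succ, oneIndexed_succ,
      show m s - i s = (m s - i s - 1) + 1 by omega, Nat.multichoose_zero_succ]

/-! ### Layered families -/

/-- The union of a list of finite sets. -/
def listUnion {α : Type*} [DecidableEq α] (l : List (Finset α)) : Finset α :=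
  l.foldr (· ∪ ·) ∅

theorem mem_listUnion {α : Type*} [DecidableEq α] {l : List (Finset α)} {x : α} :
    x ∈ listUnion l ↔ ∃ A ∈ l, x ∈ A := by
  induction l with
  | nil => simp [listUnion]
  | cons A l ih =>
    rw [listUnion, List.foldr_cons, Finset.mem_union]
    simp [← ih, listUnion]

/-- The sets `A₁, …, A_N` of the list form a path for `R`: the elements of consecutive sets are
distinct and unrelated, and those of `A_a` lie strictly `R`-below those of `A_b` if `a + 2 ≤ b`.
Empty sets are allowed, so that elements can be removed one by one. -/
def IsPathLayered {α : Type*} (R : α → α → Prop) : List (Finset α) → Prop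
  | [] => True
  | A :: l => (∀ B ∈ l.head?, ∀ x ∈ A, ∀ y ∈ B, x ≠ y ∧ ¬ R x y ∧ ¬ R y x) ∧
      (∀ B ∈ l.tail, ∀ x ∈ A, ∀ y ∈ B, R x y ∧ ¬ R y x) ∧ IsPathLayered R l

namespace IsPathLayered

variable {α : Type*} {R : α → α → Prop} {A A' B B' : Finset α} {l : List (Finset α)}

theorem not_rel [DecidableEq α] (h : IsPathLayered R (A :: l)) {x y : α} (hx : x ∈ A)
    (hy : y ∈ listUnion l) : ¬ R y x := by
  obtain ⟨B, hB, hyB⟩ := mem_listUnion.1 hy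
  cases l with
  | nil => simp at hB
  | cons C l =>
    rcases List.mem_cons.1 hB with rfl | hB
    · exact (h.1 B rfl x hx y hyB).2.2
    · exact (h.2.1 B hB x hx y hyB).2

theorem notMem [DecidableEq α] (h : IsPathLayered R (A :: l)) {x : α} (hx : x ∈ A) :
    x ∉ listUnion l := by
  intro hy
  obtain ⟨B, hB, hyB⟩ := mem_listUnion.1 hy
  cases l with
  | nil => simp at hB
  | cons C l =>
    rcases List.mem_cons.1 hB with rfl | hB
    · exact (h.1 B rfl x hx x hyB).1 rfl
    · exact (h.2.1 B hB x hx x hyB).2 (h.2.1 B hB x hx x hyB).1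

theorem mono_head (h : IsPathLayered R (A :: l)) (hA : A' ⊆ A) : IsPathLayered R (A' :: l) :=
  ⟨fun B hB x hx => h.1 B hB x (hA hx), fun B hB x hx => h.2.1 B hB x (hA hx), h.2.2⟩

theorem mono_second (h : IsPathLayered R (A :: B :: l)) (hB : B' ⊆ B) :
    IsPathLayered R (A :: B' :: l) := by
  refine ⟨?_, h.2.1, h.2.2.mono_head hB⟩
  intro C hC x hx y hy
  obtain rfl : B' = C := by simpa using hC
  exact h.1 B rfl x hx y (hB hy)

theorem ofFn {N : ℕ} {f : Fin N → Finset α}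
    (h1 : ∀ a b : Fin N, (a : ℕ) + 1 = b → ∀ x ∈ f a, ∀ y ∈ f b, x ≠ y ∧ ¬ R x y ∧ ¬ R y x)
    (h2 : ∀ a b : Fin N, (a : ℕ) + 2 ≤ b → ∀ x ∈ f a, ∀ y ∈ f b, R x y ∧ ¬ R y x) :
    IsPathLayered R (List.ofFn f) := by
  induction N with
  | zero => simp [IsPathLayered]
  | succ N ih =>
    rw [List.ofFn_succ]
    refine ⟨?_, ?_, ih (fun a b hab => h1 _ _ (by simpa using hab))
      fun a b hab => h2 _ _ (by simp only [Fin.val_succ]; omega)⟩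
    · intro B hB
      cases N with
      | zero => simp at hB
      | succ N =>
        obtain rfl : f 1 = B := by simpa using hB
        exact h1 0 1 rfl
    · intro B hB
      cases N with
      | zero => simp at hB
      | succ N =>
        rw [List.ofFn_succ, List.tail_cons, List.mem_ofFn] at hB
        obtain ⟨b, rfl⟩ := hB
        exact h2 0 _ (by simp only [Fin.val_succ, Fin.val_zero]; omega)

/-- As long as the first set is not empty, it blocks all sets but the second, so that the first
element of a linear extension is minimal in one of these two. -/
theorem minSet_listUnion [DecidableEq α] (h : IsPathLayered R (A :: B :: l)) (hA : A.Nonempty) :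
    minSet R (listUnion (A :: B :: l)) = minSet R A ∪ minSet R B := by
  have hU : ∀ x, x ∈ listUnion (A :: B :: l) ↔ x ∈ A ∨ x ∈ B ∨ x ∈ listUnion l := by
    simp [listUnion]
  have hU' : ∀ x, x ∈ listUnion (B :: l) ↔ x ∈ B ∨ x ∈ listUnion l := by
    simp [listUnion]
  ext x
  rw [Finset.mem_union, mem_minSet, mem_minSet, mem_minSet, hU]
  constructor
  · rintro ⟨hx | hx | hx, hmin⟩
    · exact .inl ⟨hx, fun y hy => hmin y ((hU y).2 (.inl hy))⟩
    · exact .inr ⟨hx, fun y hy => hmin y ((hU y).2 (.inr (.inl hy)))⟩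
    · obtain ⟨a, ha⟩ := hA
      obtain ⟨C, hC, hxC⟩ := mem_listUnion.1 hx
      have hax := hmin a ((hU a).2 (.inl ha)) (h.2.1 C hC a ha x hxC).1
      exact absurd ((hU' a).2 (.inr (hax ▸ hx))) (h.notMem ha)
  · rintro (⟨hx, hmin⟩ | ⟨hx, hmin⟩)
    · refine ⟨.inl hx, fun y hy hyx => ?_⟩
      rcases (hU y).1 hy with hy | hy
      · exact hmin y hy hyx
      · exact absurd hyx (h.not_rel hx ((hU' y).2 hy))
    · refine ⟨.inr (.inl hx), fun y hy hyx => ?_⟩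
      rcases (hU y).1 hy with hy | hy | hy
      · exact absurd hyx (h.1 B rfl y hy x hx).2.1
      · exact hmin y hy hyx
      · exact absurd hyx (h.2.2.not_rel hx hy)

/-- The counting formula for a layered family, by induction on the number of sets and elements:
removing the first element of a linear extension leaves a layered family. -/
theorem linExtCount_listUnion [DecidableEq α] (h : IsPathLayered R l) :
    linExtCount R (listUnion l) =
      (l.map (linExtCount R)).prod * chainSum 0 (l.map Finset.card) := by
  induction hn : (l.map fun A => A.card + 1).sum using Nat.strong_induction_on generalizing l with
  | _ n ih =>
  subst hn
  match l, h with
  | [], _ => simp [listUnion, linExtCount_empty, chainSum]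
  | [A], _ => simp [listUnion, chainSum_zero_singleton]
  | A :: B :: l, h =>
    rcases A.eq_empty_or_nonempty with rfl | hA
    · have := ih _ (by simp) h.2.2 rfl
      have hU : listUnion (∅ :: B :: l) = listUnion (B :: l) := by simp [listUnion]
      rw [hU, this]
      simp only [List.map_cons, List.prod_cons, linExtCount_empty, Finset.card_empty,
        chainSum_zero_cons_zero, one_mul]
    have hUne : (listUnion (A :: B :: l)).Nonempty := by
      obtain ⟨a, ha⟩ := hA
      exact ⟨a, mem_listUnion.2 ⟨A, by simp, ha⟩⟩
    have hdisj : Disjoint (minSet R A) (minSet R B) := by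
      refine Finset.disjoint_left.2 fun x hx hy => ?_
      exact (h.1 B rfl x (mem_minSet.1 hx).1 x (mem_minSet.1 hy).1).1 rfl
    have herA : ∀ x ∈ minSet R A,
        (listUnion (A :: B :: l)).erase x = listUnion (A.erase x :: B :: l) := by
      intro x hx
      have hx' := h.notMem (mem_minSet.1 hx).1
      rw [listUnion, List.foldr_cons, Finset.erase_union_distrib]
      exact congrArg _ (Finset.erase_eq_of_notMem hx')
    have herB : ∀ x ∈ minSet R B,
        (listUnion (A :: B :: l)).erase x = listUnion (A :: B.erase x :: l) := by
      intro x hx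
      have hx1 : x ∉ A := fun hA => (h.1 B rfl x hA x (mem_minSet.1 hx).1).1 rfl
      have hx' := h.2.2.notMem (mem_minSet.1 hx).1
      rw [listUnion, List.foldr_cons, List.foldr_cons, Finset.erase_union_distrib,
        Finset.erase_union_distrib, Finset.erase_eq_of_notMem hx1]
      exact congrArg _ (congrArg _ (Finset.erase_eq_of_notMem hx'))
    rw [linExtCount_eq_sum R hUne, h.minSet_listUnion hA, Finset.sum_union hdisj]
    obtain ⟨a, ha⟩ : ∃ a, A.card = a + 1 := ⟨A.card - 1, by have := hA.card_pos; omega⟩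
    have sumA : ∑ x ∈ minSet R A, linExtCount R ((listUnion (A :: B :: l)).erase x) =
        ((A :: B :: l).map (linExtCount R)).prod *
          chainSum 0 (a :: B.card :: l.map Finset.card) := by
      rw [List.map_cons, List.prod_cons, linExtCount_eq_sum R hA, Finset.sum_mul, Finset.sum_mul]
      refine Finset.sum_congr rfl fun x hx => ?_
      have hcard : (A.erase x).card = a := by
        rw [Finset.card_erase_of_mem (mem_minSet.1 hx).1, ha, Nat.add_sub_cancel]
      rw [herA x hx, ih _ ?_ (h.mono_head (A.erase_subset x)) rfl]
      · simp only [List.map_cons, List.prod_cons, hcard]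
      · simp [hcard, ha]
    rw [sumA]
    rcases B.eq_empty_or_nonempty with rfl | hB
    · -- Without a second module, all choices are in the first one.
      have : minSet R (∅ : Finset α) = ∅ := by simp [minSet]
      rw [this, Finset.sum_empty, add_zero]
      simp only [List.map_cons, Finset.card_empty, chainSum_zero_cons_zero_cons]
    obtain ⟨b, hb⟩ : ∃ b, B.card = b + 1 := ⟨B.card - 1, by have := hB.card_pos; omega⟩
    have sumB : ∑ x ∈ minSet R B, linExtCount R ((listUnion (A :: B :: l)).erase x) =
        ((A :: B :: l).map (linExtCount R)).prod *
          chainSum 0 (A.card :: b :: l.map Finset.card) := by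
      rw [List.map_cons, List.prod_cons, List.map_cons, List.prod_cons, linExtCount_eq_sum R hB,
        Finset.sum_mul, Finset.mul_sum, Finset.sum_mul]
      refine Finset.sum_congr rfl fun x hx => ?_
      have hcard : (B.erase x).card = b := by
        rw [Finset.card_erase_of_mem (mem_minSet.1 hx).1, hb, Nat.add_sub_cancel]
      rw [herB x hx, ih _ ?_ (h.mono_second (B.erase_subset x)) rfl]
      · simp only [List.map_cons, List.prod_cons, hcard]
      · simp [hcard, hb]
    rw [sumB, List.map_cons (f := Finset.card), List.map_cons (f := Finset.card), ha, hb,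
      chainSum_zero_succ_succ, mul_add]

end IsPathLayered

/-! ### Unions of completely comparable sets -/

theorem minSet_union_of_comparable {α : Type*} [DecidableEq α] [PartialOrder α] {A B : Finset α}
    (hd : Disjoint A B) (hc : ∀ x ∈ A, ∀ y ∈ B, x ≤ y ∨ y ≤ x) {x₀ : α} (hx₀ : x₀ ∈ A)
    (hmin : x₀ ∈ minSet (· ≤ ·) (A ∪ B)) : minSet (· ≤ ·) (A ∪ B) = minSet (· ≤ ·) A := by
  have key : ∀ z ∈ minSet (· ≤ ·) (A ∪ B), z ∈ A := by
    intro z hz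
    rw [mem_minSet] at hz hmin
    refine (Finset.mem_union.1 hz.1).resolve_right fun hzB => ?_
    refine Finset.disjoint_left.1 hd hx₀ ?_
    rcases hc x₀ hx₀ z hzB with h | h
    · exact (hz.2 x₀ hmin.1 h).symm ▸ hzB
    · exact hmin.2 z hz.1 h ▸ hzB
  ext z
  refine ⟨fun hz => mem_minSet.2 ⟨key z hz, fun y hy =>
    (mem_minSet.1 hz).2 y (Finset.mem_union_left _ hy)⟩, fun hz => ?_⟩
  rw [mem_minSet] at hz ⊢
  refine ⟨Finset.mem_union_left _ hz.1, fun y hy hyz => ?_⟩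
  rcases Finset.mem_union.1 hy with hy' | hy'
  · exact hz.2 y hy' hyz
  · obtain ⟨w, hwy, hw⟩ := Finset.exists_le_minimal _ hy
    have hwA : w ∈ A := key w (mem_minSet.2 ⟨hw.1, fun v hv hvw => le_antisymm hvw (hw.2 hv hvw)⟩)
    have hwz := hz.2 w hwA (hwy.trans hyz)
    exact le_antisymm hyz (hwz ▸ hwy)

/-- If all elements of `A` are comparable to all elements of `B`, then the two orders determine
how linear extensions of `A` and `B` are merged, even if `A` and `B` are interleaved. -/
theorem linExtCount_union_of_comparable {α : Type*} [DecidableEq α] [PartialOrder α]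
    {A B : Finset α} (hd : Disjoint A B) (hc : ∀ x ∈ A, ∀ y ∈ B, x ≤ y ∨ y ≤ x) :
    linExtCount (· ≤ ·) (A ∪ B) = linExtCount (· ≤ ·) A * linExtCount (· ≤ ·) B := by
  induction hn : (A ∪ B).card using Nat.strong_induction_on generalizing A B with
  | _ n ih =>
  subst hn
  rcases (A ∪ B).eq_empty_or_nonempty with hU | hU
  · obtain ⟨rfl, rfl⟩ := Finset.union_eq_empty.1 hU
    simp [linExtCount_empty]
  obtain ⟨x₀, hx₀⟩ : ∃ x₀, x₀ ∈ minSet (· ≤ ·) (A ∪ B) := by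
    obtain ⟨x, hx⟩ := (A ∪ B).exists_minimal hU
    exact ⟨x, mem_minSet.2 ⟨hx.1, fun y hy hyx => le_antisymm hyx (hx.2 hy hyx)⟩⟩
  wlog hA : x₀ ∈ A generalizing A B
  · have hB : x₀ ∈ B := (Finset.mem_union.1 (mem_minSet.1 hx₀).1).resolve_left hA
    rw [Finset.union_comm, mul_comm]
    rw [Finset.union_comm] at ih hU hx₀
    exact this hd.symm (fun x hx y hy => (hc y hy x hx).symm) ih hU hx₀ hB
  rw [linExtCount_eq_sum _ hU, minSet_union_of_comparable hd hc hA hx₀,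
    linExtCount_eq_sum _ ⟨x₀, hA⟩, Finset.sum_mul]
  refine Finset.sum_congr rfl fun x hx => ?_
  have hxA := (mem_minSet.1 hx).1
  have her : (A ∪ B).erase x = A.erase x ∪ B := by
    rw [Finset.erase_union_distrib, Finset.erase_eq_of_notMem (Finset.disjoint_left.1 hd hxA)]
  rw [her]
  refine ih _ ?_ (hd.mono_left (A.erase_subset x))
    (fun y hy => hc y (Finset.mem_of_mem_erase hy)) rfl
  rw [← her]
  exact Finset.card_erase_lt_of_mem (Finset.mem_union_left _ hxA)

/-! ### The orientation of the comparabilities -/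

/-- For at least four modules, the complement of the path is connected through moves that keep the
orientation: if `x` is comparable to both ends of an edge of the incomparability graph, then it
lies on the same side of both. Hence one comparability between the end modules orients all
comparabilities between different modules. -/
theorem rel_of_path {α : Type*} {R : α → α → Prop} (trans : ∀ x y z, R x y → R y z → R x z)
    {N : ℕ} (hN : 4 ≤ N) {c : α → ℕ} (surj : ∀ k < N, ∃ x, c x = k) (hlt : ∀ x, c x < N)
    (adj : ∀ x y, c x + 1 = c y → ¬ R x y ∧ ¬ R y x)
    (far : ∀ x y, c x + 2 ≤ c y → R x y ∨ R y x)
    {x₀ y₀ : α} (hx₀ : c x₀ = 0) (hy₀ : c y₀ + 1 = N) (h₀ : R x₀ y₀) :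
    ∀ x y, c x + 2 ≤ c y → R x y := by
  have move_right : ∀ x y z, R x y → c x + 2 ≤ c z → (c y + 1 = c z ∨ c z + 1 = c y) → R x z := by
    intro x y z hxy hxz hyz
    refine (far x z hxz).resolve_right fun hzx => ?_
    have hzy := trans z x y hzx hxy
    rcases hyz with h | h
    · exact (adj y z h).2 hzy
    · exact (adj z y h).1 hzy
  have move_left : ∀ x y z, R x y → c z + 2 ≤ c y → (c x + 1 = c z ∨ c z + 1 = c x) → R z y := by
    intro x y z hxy hzy hxz
    refine (far z y hzy).resolve_right fun hyz => ?_
    have hxz' := trans x y z hxy hyz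
    rcases hxz with h | h
    · exact (adj x z h).1 hxz'
    · exact (adj z x h).2 hxz'
  have h1 : ∀ y, c y + 1 = N → R x₀ y := by
    intro y hy
    obtain ⟨z, hz⟩ := surj (N - 2) (by omega)
    exact move_right _ z _ (move_right _ y₀ _ h₀ (by omega) (by omega)) (by omega) (by omega)
  have h2 : ∀ k y, k + 3 ≤ N → c y + k + 1 = N → R x₀ y := by
    intro k
    induction k with
    | zero => exact fun y _ hy => h1 y hy
    | succ k ih =>
      intro y hk hy
      obtain ⟨z, hz⟩ := surj (N - 1 - k) (by omega)
      exact move_right _ z _ (ih z (by omega) (by omega)) (by omega) (by omega)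
  have h3 : ∀ x y, c x = 0 → 3 ≤ c y → R x y := by
    intro x y hx hy
    have := hlt y
    obtain ⟨z, hz⟩ := surj 1 (by omega)
    have hxy := h2 (N - 1 - c y) y (by omega) (by omega)
    exact move_left z _ _ (move_left x₀ _ _ hxy (by omega) (by omega)) (by omega) (by omega)
  have h4 : ∀ x y, c x = 0 → 2 ≤ c y → R x y := by
    intro x y hx hy
    obtain ⟨z, hz⟩ := surj 3 (by omega)
    rcases hy.lt_or_eq with hy | hy
    · exact h3 x y hx hy
    · exact move_right _ z _ (h3 x z hx (by omega)) (by omega) (by omega)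
  have h5 : ∀ k x y, c x = k → k + 2 ≤ c y → R x y := by
    intro k
    induction k with
    | zero => exact fun x y hx hy => h4 x y hx (by omega)
    | succ k ih =>
      intro x y hx hy
      have := hlt y
      obtain ⟨z, hz⟩ := surj k (by omega)
      exact move_left z _ _ (ih z y hz (by omega)) (by omega) (by omega)
  exact fun x y h => h5 _ x y rfl h

/-! ### Modular partitions with a path as skeleton -/

/-- In terms of the map `c` to the index of the module, the skeleton is a path exactly when elements
of different modules are incomparable iff their modules are consecutive. -/
theorem incompGraph_adj_iff_of_path {P : Type*} [PartialOrder P] {N : ℕ} {M : Fin N → Set P}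
    (hM : IsModularPartition (incompGraph P) M)
    (hpath : skeleton (incompGraph P) M = SimpleGraph.pathGraph N) {a b : Fin N} (hab : a ≠ b)
    {x y : P} (hx : x ∈ M a) (hy : y ∈ M b) :
    (incompGraph P).Adj x y ↔ (a : ℕ) + 1 = b ∨ (b : ℕ) + 1 = a := by
  rw [← SimpleGraph.pathGraph_adj, ← hpath]
  refine ⟨fun h => ⟨hab, x, hx, y, hy, h⟩, ?_⟩
  rintro ⟨-, x', hx', y', hy', h⟩
  have h1 := ((hM.isModule a).2 x hx x' hx' y'
    (Set.disjoint_right.1 (hM.disjoint a b hab) hy')).2 h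
  exact (((hM.isModule b).2 y hy y' hy' x
    (Set.disjoint_left.1 (hM.disjoint a b hab) hx)).2 h1.symm).symm

theorem linExtCount_univ_of_path {P : Type*} [Fintype P] {N : ℕ} (R : P → P → Prop)
    {L : Fin N → Finset P} (hL : ∀ v, ∃ a, v ∈ L a)
    (h1 : ∀ a b : Fin N, (a : ℕ) + 1 = b → ∀ x ∈ L a, ∀ y ∈ L b, x ≠ y ∧ ¬ R x y ∧ ¬ R y x)
    (h2 : ∀ a b : Fin N, (a : ℕ) + 2 ≤ b → ∀ x ∈ L a, ∀ y ∈ L b, R x y ∧ ¬ R y x) :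
    linExtCount R Finset.univ =
      (∏ s, linExtCount R (L s)) * chainSum 0 (List.ofFn fun s => (L s).card) := by
  classical
  have hU : listUnion (List.ofFn L) = Finset.univ := by
    ext v
    simpa [mem_listUnion] using hL v
  rw [← hU, (IsPathLayered.ofFn h1 h2).linExtCount_listUnion, List.map_ofFn, List.map_ofFn,
    List.prod_ofFn]
  rfl

theorem numLinearExtensions_eq_linExtCount_univ (P : Type*) [PartialOrder P] [Fintype P] :
    numLinearExtensions P = linExtCount (· ≤ ·) (Finset.univ : Finset P) :=
  linExt_ncard_congr (R := fun x y : P => x ≤ y)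
    (Equiv.subtypeUnivEquiv Finset.mem_univ).symm fun _ _ => Iff.rfl

theorem numLinearExtensions_eq_linExtCount {P : Type*} [PartialOrder P] {M : Set P} {L : Finset P}
    (h : ∀ x, x ∈ L ↔ x ∈ M) : numLinearExtensions M = linExtCount (· ≤ ·) L :=
  linExt_ncard_congr (R := fun x y : M => x ≤ y)
    (Equiv.subtypeEquivRight fun x => (h x).symm) fun _ _ => Iff.rfl

/-- For three modules the first and the third one may be interleaved. They are merged into one set
that is unrelated to the second module, and the formula depends only on the sizes. -/
theorem linExtCount_univ_of_three {P : Type*} [PartialOrder P] [Fintype P] {L : Fin 3 → Finset P}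
    (hL : ∀ v, ∃ a, v ∈ L a) (hd : Disjoint (L 0) (L 2))
    (hc : ∀ x ∈ L 0, ∀ y ∈ L 2, x ≤ y ∨ y ≤ x)
    (h01 : ∀ x ∈ L 0, ∀ y ∈ L 1, x ≠ y ∧ ¬ x ≤ y ∧ ¬ y ≤ x)
    (h21 : ∀ x ∈ L 2, ∀ y ∈ L 1, x ≠ y ∧ ¬ x ≤ y ∧ ¬ y ≤ x) :
    linExtCount (· ≤ ·) (Finset.univ : Finset P) =
      (∏ s, linExtCount (· ≤ ·) (L s)) * chainSum 0 (List.ofFn fun s => (L s).card) := by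
  classical
  have hlay : IsPathLayered (fun x y : P => x ≤ y) [L 0 ∪ L 2, L 1] := by
    refine ⟨?_, by simp, by simp [IsPathLayered]⟩
    intro B hB x hx y hy
    obtain rfl : L 1 = B := by simpa using hB
    exact (Finset.mem_union.1 hx).elim (fun hx => h01 x hx y hy) fun hx => h21 x hx y hy
  have hU : listUnion [L 0 ∪ L 2, L 1] = Finset.univ := by
    ext v
    obtain ⟨a, ha⟩ := hL v
    fin_cases a <;> simp_all [mem_listUnion]
  rw [← hU, hlay.linExtCount_listUnion]
  simp only [List.map_cons, List.map_nil, List.prod_cons, List.prod_nil, mul_one,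
    linExtCount_union_of_comparable hd hc, Finset.card_union_of_disjoint hd, chainSum_zero_pair,
    Fin.prod_univ_three, List.ofFn_succ, List.ofFn_zero]
  have h3 := chainSum_zero_triple (L 0).card (L 1).card (L 2).card
  have h4 : (L 0).card + (L 2).card + (L 1).card = (L 0).card + (L 1).card + (L 2).card := by ring
  rw [h4, ← h3]
  exact congrArg (· * _) (mul_right_comm _ _ _)

theorem linExtCount_univ_of_four_le {P : Type*} [PartialOrder P] [Fintype P] {N : ℕ} (hN : 4 ≤ N)
    {L : Fin N → Finset P} {c : P → Fin N} (hc : ∀ x a, x ∈ L a ↔ c x = a)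
    (surj : ∀ a, ∃ x, c x = a)
    (adj : ∀ x y, (c x : ℕ) + 1 = c y → ¬ x ≤ y ∧ ¬ y ≤ x)
    (far : ∀ x y, (c x : ℕ) + 2 ≤ c y → x ≤ y ∨ y ≤ x) :
    linExtCount (· ≤ ·) (Finset.univ : Finset P) =
      (∏ s, linExtCount (· ≤ ·) (L s)) * chainSum 0 (List.ofFn fun s => (L s).card) := by
  have surj' : ∀ k < N, ∃ x, (c x : ℕ) = k := fun k hk =>
    (surj ⟨k, hk⟩).imp fun x hx => congrArg Fin.val hx
  -- It suffices that the order or its dual orients all comparabilities upwards.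
  have main : ∀ R : P → P → Prop, (∀ x y, (c x : ℕ) + 1 = c y → ¬ R x y ∧ ¬ R y x) →
      (∀ x y, R x y → R y x → x = y) → (∀ x y, (c x : ℕ) + 2 ≤ c y → R x y) →
      linExtCount R Finset.univ =
        (∏ s, linExtCount R (L s)) * chainSum 0 (List.ofFn fun s => (L s).card) := by
    intro R hadj hanti hfar
    refine linExtCount_univ_of_path R (fun v => ⟨c v, (hc _ _).2 rfl⟩) ?_ ?_
    · intro a b hab x hx y hy
      rw [hc] at hx hy
      subst hx hy
      refine ⟨?_, hadj x y hab⟩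
      rintro rfl
      omega
    · intro a b hab x hx y hy
      rw [hc] at hx hy
      subst hx hy
      refine ⟨hfar x y hab, fun hyx => ?_⟩
      obtain rfl := hanti x y (hfar x y hab) hyx
      omega
  obtain ⟨x₀, hx₀⟩ := surj' 0 (by omega)
  obtain ⟨y₀, hy₀⟩ := surj' (N - 1) (by omega)
  have hy₁ : (c y₀ : ℕ) + 1 = N := by omega
  rcases far x₀ y₀ (by omega) with h | h
  · exact main _ adj (fun x y => le_antisymm) (rel_of_path (R := (· ≤ ·)) (fun _ _ _ => le_trans) hN
      surj' (fun x => (c x).2) adj far hx₀ hy₁ h)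
  · have := main (flip (· ≤ ·)) (fun x y h => (adj x y h).symm)
      (fun x y hxy hyx => le_antisymm hyx hxy)
      (rel_of_path (R := flip (· ≤ ·)) (fun x y z (hxy : y ≤ x) (hyz : z ≤ y) => hyz.trans hxy)
        hN surj' (fun x => (c x).2) (fun x y h => (adj x y h).symm) (fun x y h => (far x y h).symm)
        hx₀ hy₁ h)
    simpa only [linExtCount_flip] using this

/-! ### The counting formula -/

theorem theorem3p1 {P : Type*} [PartialOrder P] [Finite P] {N : ℕ} (M : Fin N → Set P)
    (hM : IsModularPartition (incompGraph P) M)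
    (hpath : skeleton (incompGraph P) M = SimpleGraph.pathGraph N)
    (m : Fin N → ℕ) (hm : ∀ s, m s = (M s).ncard) :
    (numLinearExtensions P : ℤ) =
      (∏ s : Fin N, (numLinearExtensions (M s) : ℤ)) *
        ∑ i ∈ indexTuples m, ∏ d ∈ Finset.range (N + 1),
          Ring.choose
            ((oneIndexed m d : ℤ) - (oneIndexed i d : ℤ) + (oneIndexed i (d + 1) : ℤ) - 1)
            (oneIndexed m d - oneIndexed i d) := by
  classical
  have := Fintype.ofFinite P
  set L : Fin N → Finset P := fun s => (M s).toFinite.toFinset with hLdef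
  have hLM : ∀ s x, x ∈ L s ↔ x ∈ M s := fun s x => Set.Finite.mem_toFinset _
  have hmL : m = fun s => (L s).card :=
    funext fun s => (hm s).trans (Set.ncard_eq_toFinset_card _ _)
  choose c hcM using hM.cover
  have hc : ∀ x a, x ∈ L a ↔ c x = a := by
    intro x a
    rw [hLM]
    refine ⟨fun hx => ?_, fun h => h ▸ hcM x⟩
    by_contra hne
    exact Set.disjoint_left.1 (hM.disjoint _ _ hne) (hcM x) hx
  have surj : ∀ a, ∃ x, c x = a := fun a =>
    (hM.isModule a).1.imp fun x hx => (hc x a).1 ((hLM a x).2 hx)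
  have adj : ∀ x y, (c x : ℕ) + 1 = c y → ¬ x ≤ y ∧ ¬ y ≤ x := fun x y h =>
    (incompGraph_adj_iff_of_path hM hpath (fun he => by rw [he] at h; omega)
      (hcM x) (hcM y)).2 (.inl h)
  have far : ∀ x y, (c x : ℕ) + 2 ≤ c y → x ≤ y ∨ y ≤ x := by
    intro x y h
    by_contra! hxy
    have := (incompGraph_adj_iff_of_path hM hpath (fun he => by rw [he] at h; omega)
      (hcM x) (hcM y)).1 hxy
    omega
  have hadjL : ∀ a b : Fin N, (a : ℕ) + 1 = b → ∀ x ∈ L a, ∀ y ∈ L b,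
      x ≠ y ∧ ¬ x ≤ y ∧ ¬ y ≤ x := by
    intro a b hab x hx y hy
    rw [hc] at hx hy
    subst hx hy
    exact ⟨fun he => (adj x y hab).1 he.le, adj x y hab⟩
  have key : linExtCount (· ≤ ·) (Finset.univ : Finset P) =
      (∏ s, linExtCount (· ≤ ·) (L s)) * chainSum 0 (List.ofFn fun s => (L s).card) := by
    -- With at most two modules there are no comparabilities to orient.
    rcases lt_trichotomy N 3 with hN | rfl | hN
    · exact linExtCount_univ_of_path _ (fun v => ⟨c v, (hc _ _).2 rfl⟩) hadjL
        fun a b hab => by omega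
    · refine linExtCount_univ_of_three (fun v => ⟨c v, (hc _ _).2 rfl⟩) ?_ ?_ (hadjL 0 1 rfl) ?_
      · refine Finset.disjoint_left.2 fun x hx hx' => ?_
        rw [hc] at hx hx'
        exact absurd (hx.symm.trans hx') (by decide)
      · intro x hx y hy
        rw [hc] at hx hy
        exact far x y (by rw [hx, hy]; decide)
      · intro x hx y hy
        obtain ⟨h1, h2, h3⟩ := hadjL 1 2 rfl y hy x hx
        exact ⟨h1.symm, h3, h2⟩
    · exact linExtCount_univ_of_four_le hN hc surj adj far
  rw [sum_indexTuples_eq_chainSum, numLinearExtensions_eq_linExtCount_univ, key, hmL]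
  simp only [fun s => numLinearExtensions_eq_linExtCount (hLM s)]
  push_cast
  rfl
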